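/- Let $H$ be a finite simple graph with vertices $x_1,\dots,x_n$, and let $G=W(H)$ be its whisker graph: $V(G)=V(H)\cup\{y_1,\dots,y_n\}$ with new vertices $y_i$, and $E(G)=E(H)\cup\{\{x_i,y_i\}: 1\le i\le n\}$. Let $m=\operatorname{girth}(H)$ be the length of a shortest cycle of $H$, with $m=\infty$ if $H$ is acyclic, and let $\nu(G)$ be the maximum size of a matching of $G$. For $q\ge 1$ let $\mathsf{MF}^q(G)$ be the simplicial complex of all $F\subseteq V(G)$ for which the induced subgraph $G[F]$ contains no matching of size $q$. Then $\mathsf{MF}^q(G)$ is shellable (in the not necessarily pure sense: its facets can be ordered $F_1,\dots,F_t$ such that for every $k=2,\dots,t$ the complex $\bigl(\bigcup_{i<k}\langle F_i\rangle\bigr)\cap\langle F_k\rangle$ is pure of dimension $\dim F_k-1$, where $\langle F\rangle$ is the simplex of all subsets of $F$) for all \[ 1\le q\le \begin{cases}\lceil m/2\rceil, & \text{if } m<\infty,\\ \nu(G), & \text{if } m=\infty.\end{cases} \] -/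

import Mathlib

namespace SimpleGraph

/-- The whisker graph `W(H)`: its vertices are the vertices `x` of `H` (as `Sum.inl x`) and one
new vertex `y_x` (as `Sum.inr x`) for each vertex `x` of `H`; its edges are the edges of `H` and
the whiskers `{x, y_x}`. -/
def whisker {V : Type*} (H : SimpleGraph V) : SimpleGraph (V ⊕ V) where
  Adj
    | .inl a, .inl b => H.Adj a b
    | .inl a, .inr b => a = b
    | .inr a, .inl b => a = b
    | .inr _, .inr _ => False
  symm := ⟨by
    rintro (a | a) (b | b) h
    · exact SimpleGraph.Adj.symm h
    · exact Eq.symm h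
    · exact Eq.symm h
    · exact h⟩
  loopless := ⟨by
    rintro (a | a) h
    · exact H.irrefl h
    · exact h⟩

/-- A finite set `M` of edges of `G` is a matching if its members are pairwise disjoint. -/
def IsEdgeMatching {V : Type*} (G : SimpleGraph V) (M : Finset (Sym2 V)) : Prop :=
  (∀ e ∈ M, e ∈ G.edgeSet) ∧ ∀ e ∈ M, ∀ f ∈ M, e ≠ f → ∀ v, v ∈ e → v ∉ f

/-- `G` contains a matching of size `q`. -/
def HasMatchingOfSize {V : Type*} (G : SimpleGraph V) (q : ℕ) : Prop :=
  ∃ M : Finset (Sym2 V), G.IsEdgeMatching M ∧ M.card = q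

/-- The matching number `ν(G)`: the maximum size of a matching of `G` (used for finite graphs). -/
noncomputable def matchingNum {V : Type*} (G : SimpleGraph V) : ℕ :=
  sSup {k | G.HasMatchingOfSize k}

/-- An injective graph homomorphism carries matchings to matchings of the same size. -/
theorem HasMatchingOfSize.map {V W : Type*} {G : SimpleGraph V} {G' : SimpleGraph W} {q : ℕ}
    (f : G →g G') (hf : Function.Injective f) (h : G.HasMatchingOfSize q) :
    G'.HasMatchingOfSize q := by
  obtain ⟨M, ⟨hE, hD⟩, hc⟩ := h
  refine ⟨M.map ⟨Sym2.map f, Sym2.map.injective hf⟩, ⟨?_, ?_⟩, by simpa using hc⟩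
  · intro e he
    obtain ⟨a, ha, rfl⟩ := Finset.mem_map.1 he
    exact f.map_mem_edgeSet (hE a ha)
  · intro e he e' he' hne v hv hv'
    obtain ⟨a, ha, rfl⟩ := Finset.mem_map.1 he
    obtain ⟨b, hb, rfl⟩ := Finset.mem_map.1 he'
    obtain ⟨x, hx, rfl⟩ := Sym2.mem_map.1 hv
    obtain ⟨y, hy, hxy⟩ := Sym2.mem_map.1 hv'
    obtain rfl := hf hxy
    exact hD a ha b hb (fun hab => hne (by rw [hab])) y hx hy

/-- The `q`-matching-free complex `MF^q(G)`: the sets `F` of vertices for which the induced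
subgraph `G[F]` contains no matching of size `q`. Here a simplicial complex is a family of finite
sets closed under taking subsets, that is, a lower set of finsets; the empty face is allowed. -/
def matchingFreeComplex {V : Type*} (G : SimpleGraph V) (q : ℕ) : LowerSet (Finset V) where
  carrier := {F | ¬ (G.induce (F : Set V)).HasMatchingOfSize q}
  lower' := by
    intro F F' hle hF h
    have hs : (F' : Set V) ⊆ (F : Set V) := Finset.coe_subset.2 hle
    exact hF (h.map (induceHomOfLE G hs).toHom (induceHomOfLE G hs).injective)

/-- For `q ≥ 1` every vertex of `G` is a vertex of `MF^q(G)`. -/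
theorem singleton_mem_matchingFreeComplex {V : Type*} (G : SimpleGraph V) {q : ℕ} (hq : 1 ≤ q)
    (v : V) : ({v} : Finset V) ∈ G.matchingFreeComplex q := by
  rintro ⟨M, ⟨hE, -⟩, hc⟩
  obtain ⟨e, he⟩ := Finset.card_pos.1 (hc ▸ hq)
  have h := hE e he
  induction e with
  | h a b =>
    have ha := Finset.mem_singleton.1 a.2
    have hb := Finset.mem_singleton.1 b.2
    exact (SimpleGraph.mem_edgeSet _).1 h |>.ne (Subtype.ext (ha.trans hb.symm))

end SimpleGraph

/-- The facets of a simplicial complex: its inclusion-maximal faces. -/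
def complexFacets {V : Type*} (Δ : LowerSet (Finset V)) : Set (Finset V) :=
  {F | Maximal (· ∈ Δ) F}

/-- The dimension of a face, `dim F = |F| - 1` (so the empty face has dimension `-1`). -/
def faceDim {V : Type*} (F : Finset V) : ℤ := (F.card : ℤ) - 1

/-- `Δ` is pure of dimension `d`: it has a face, and all its facets have dimension `d`. -/
def IsPureOfDim {V : Type*} (Δ : LowerSet (Finset V)) (d : ℤ) : Prop :=
  (∃ F, F ∈ Δ) ∧ ∀ F ∈ complexFacets Δ, faceDim F = d

/-- (Not necessarily pure) shellability: the facets can be listed without repetition as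
`F₀, …, F_{t-1}` such that for every `k ≥ 1` the complex `(⋃_{i < k} ⟨F_i⟩) ∩ ⟨F_k⟩` is pure of
dimension `dim F_k - 1`. The simplex `⟨F⟩` of all subsets of `F` is `LowerSet.Iic F`. -/
def IsShellableComplex {V : Type*} (Δ : LowerSet (Finset V)) : Prop :=
  ∃ (t : ℕ) (F : Fin t → Finset V), Function.Injective F ∧ Set.range F = complexFacets Δ ∧
    ∀ k : Fin t, 0 < k.val →
      IsPureOfDim ((⨆ i : Fin t, ⨆ _ : i < k, LowerSet.Iic (F i)) ⊓ LowerSet.Iic (F k))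
        (faceDim (F k) - 1)

/-! The girth enters only through one consequence: every cycle of `H` has at least 2q - 1 vertices.
Describe a set of vertices by its complement, the x_i with i in A and the y_i with i in B.

If a face induces a forest on its part in `H`, it induces a forest in `W(H)`, and Kőnig's theorem
gives a cover with fewer than q vertices. This puts the face inside a cover pair: A and B disjoint,
B independent, |A| + |B| = |V| + 1 - q. Otherwise the face contains a cycle C, which must have
exactly 2q - 1 vertices. As C minus any vertex has a matching of size q - 1, all edges of the face
lie in C, and the face is inside a cycle pair. These two kinds of pairs give exactly the facets
(`complexFacets_whisker`).

Cover pairs are listed by increasing |B|, and cycle pairs come after them, also by increasing |B|.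
If A' is not contained in A and B is nonempty, moving an element into A and deleting one from B
gives an earlier facet. If A' = A, the graph left on the complement of A is a forest; in an
elimination order each vertex has at most one smaller neighbour, so one element of B can be
exchanged for a larger one with B still independent. Thus sets B that are larger in colex order come
first. A cycle pair that loses a vertex of C falls into a cover pair, and one that loses a vertex of
D falls into a smaller cycle pair. -/

/-- A sorting criterion for shellability. The facets are parametrized by `s`; ties of the key `κ`
may be broken arbitrarily. -/
theorem isShellableComplex_of_key {W ι α : Type*} [DecidableEq W] [LinearOrder α]
    {Δ : LowerSet (Finset W)} {s : Set ι} (hs : s.Finite) (φ : ι → Finset W)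
    (hinj : Set.InjOn φ s) (hfac : complexFacets Δ = φ '' s) (κ : ι → α)
    (h : ∀ x ∈ s, ∀ x' ∈ s, x' ≠ x → κ x' ≤ κ x → ∃ w ∈ φ x, w ∉ φ x' ∧
      ∃ x'' ∈ s, κ x'' < κ x ∧ (φ x).erase w ⊆ φ x'') :
    IsShellableComplex Δ := by
  classical
  have : Fintype s := hs.fintype
  obtain ⟨t, ⟨e⟩⟩ := Finite.exists_equiv_fin s
  set f : Fin t → α := fun i => κ (e.symm i)
  set g : Fin t → s := fun i => e.symm (Tuple.sort f i) with hg
  have hginj : Function.Injective g := e.symm.injective.comp (Tuple.sort f).injective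
  have hgsurj : Function.Surjective g := e.symm.surjective.comp (Tuple.sort f).surjective
  have hmono : Monotone fun i => κ (g i) := Tuple.monotone_sort f
  refine ⟨t, fun i => φ (g i), ?_, ?_, ?_⟩
  · intro i j hij
    exact hginj (Subtype.ext (hinj (g i).2 (g j).2 hij))
  · rw [hfac]
    ext F
    constructor
    · rintro ⟨i, rfl⟩
      exact ⟨g i, (g i).2, rfl⟩
    · rintro ⟨x, hx, rfl⟩
      obtain ⟨i, hi⟩ := hgsurj ⟨x, hx⟩
      exact ⟨i, by simp [hi]⟩
  · intro k hk
    refine ⟨⟨∅, ?_⟩, ?_⟩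
    · simp only [LowerSet.mem_inf_iff, LowerSet.mem_iSup_iff, LowerSet.mem_Iic_iff]
      exact ⟨⟨⟨0, by omega⟩, hk, by simp⟩, by simp⟩
    · intro F hF
      have hF1 := hF.prop
      simp only [LowerSet.mem_inf_iff, LowerSet.mem_iSup_iff, LowerSet.mem_Iic_iff] at hF1
      obtain ⟨⟨i, hik, hFi⟩, hFk⟩ := hF1
      obtain ⟨w, hw, hw', x'', hx'', hlt, hsub⟩ := h (g k) (g k).2 (g i) (g i).2
        (fun he => hik.ne (hginj (Subtype.ext he))) (hmono hik.le)
      obtain ⟨j, hj⟩ := hgsurj ⟨x'', hx''⟩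
      have hjk : j < k := by
        by_contra hcon
        have := hmono (not_lt.1 hcon)
        simp only [hj] at this
        exact absurd hlt (not_lt.2 this)
      have hFe : F ⊆ (φ (g k)).erase w := fun v hv =>
        Finset.mem_erase.2 ⟨fun hvw => hw' (hFi (hvw ▸ hv)), hFk hv⟩
      have hmem : (φ (g k)).erase w ∈ ((⨆ i : Fin t, ⨆ _ : i < k, LowerSet.Iic (φ (g i))) ⊓
          LowerSet.Iic (φ (g k))) := by
        simp only [LowerSet.mem_inf_iff, LowerSet.mem_iSup_iff, LowerSet.mem_Iic_iff]
        exact ⟨⟨j, hjk, by simpa [hj] using hsub⟩, Finset.erase_subset _ _⟩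
      -- The set `(φ (g k)).erase w` lies in the intersection and contains the maximal face `F`, so
      -- the two agree.
      have heq : F = (φ (g k)).erase w := le_antisymm hFe (hF.le_of_ge hmem hFe)
      have hpos : 0 < (φ (g k)).card := Finset.card_pos.2 ⟨w, hw⟩
      rw [heq]
      simp only [faceDim, Finset.card_erase_of_mem hw]
      omega

/-! ### Matchings, vertex covers and forests -/

namespace SimpleGraph

/-- `F` contains the vertices of a matching of `G` of size `q`. -/
def HasMatchingWithin {V : Type*} (G : SimpleGraph V) (F : Finset V) (q : ℕ) : Prop :=
  ∃ M : Finset (Sym2 V), G.IsEdgeMatching M ∧ (∀ e ∈ M, ∀ v ∈ e, v ∈ F) ∧ M.card = q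

/-- `K` meets every edge of `G` inside `F`. -/
def CoversWithin {V : Type*} (G : SimpleGraph V) (F K : Finset V) : Prop :=
  ∀ u ∈ F, ∀ v ∈ F, G.Adj u v → u ∈ K ∨ v ∈ K

/-- Every nonempty subset of `S` contains a vertex with at most one neighbour in that subset. -/
def SparseOn {V : Type*} (G : SimpleGraph V) (S : Finset V) : Prop :=
  ∀ T ⊆ S, T.Nonempty → ∃ v ∈ T, ∀ u ∈ T, ∀ u' ∈ T, G.Adj v u → G.Adj v u' → u = u'

section Matching

variable {V W : Type*} {G : SimpleGraph V} {G' : SimpleGraph W} {F F' K : Finset V} {q r : ℕ}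

theorem HasMatchingWithin.map {F' : Finset W} (f : G →g G') (hf : Function.Injective f)
    (hF : ∀ v ∈ F, f v ∈ F') (h : G.HasMatchingWithin F q) : G'.HasMatchingWithin F' q := by
  obtain ⟨M, ⟨hE, hD⟩, hin, hc⟩ := h
  refine ⟨M.map ⟨Sym2.map f, Sym2.map.injective hf⟩, ⟨?_, ?_⟩, ?_, by simpa using hc⟩
  · intro e he
    obtain ⟨a, ha, rfl⟩ := Finset.mem_map.1 he
    exact f.map_mem_edgeSet (hE a ha)
  · intro e he e' he' hne v hv hv'
    obtain ⟨a, ha, rfl⟩ := Finset.mem_map.1 he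
    obtain ⟨b, hb, rfl⟩ := Finset.mem_map.1 he'
    obtain ⟨x, hx, rfl⟩ := Sym2.mem_map.1 hv
    obtain ⟨y, hy, hxy⟩ := Sym2.mem_map.1 hv'
    obtain rfl := hf hxy
    exact hD a ha b hb (fun hab => hne (by rw [hab])) y hx hy
  · intro e he v hv
    obtain ⟨a, ha, rfl⟩ := Finset.mem_map.1 he
    obtain ⟨x, hx, rfl⟩ := Sym2.mem_map.1 hv
    exact hF x (hin a ha x hx)

theorem hasMatchingOfSize_induce_iff :
    (G.induce (F : Set V)).HasMatchingOfSize q ↔ G.HasMatchingWithin F q := by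
  classical
  constructor
  · rintro ⟨M, hM, hc⟩
    have h : (G.induce (F : Set V)).HasMatchingWithin Finset.univ q :=
      ⟨M, hM, fun e _ v _ => by simp, hc⟩
    exact h.map (Embedding.induce (G := G) (F : Set V)).toHom Subtype.val_injective
      (fun v _ => v.2)
  · rintro ⟨M, ⟨hE, hD⟩, hin, hc⟩
    have hval : ∀ e ∈ M, ∃ e' : Sym2 (F : Set V), Sym2.map Subtype.val e' = e := by
      intro e he
      induction e with
      | h a b =>
        exact ⟨s(⟨a, hin _ he a (by simp)⟩, ⟨b, hin _ he b (by simp)⟩), by simp⟩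
    refine ⟨M.preimage (Sym2.map Subtype.val) (Sym2.map.injective Subtype.val_injective).injOn,
      ⟨?_, ?_⟩, ?_⟩
    · intro e he
      have := hE _ (Finset.mem_preimage.1 he)
      induction e with
      | h a b => simpa using this
    · intro e he e' he' hne v hv hv'
      exact hD _ (Finset.mem_preimage.1 he) _ (Finset.mem_preimage.1 he')
        (fun h => hne (Sym2.map.injective Subtype.val_injective h)) v
        (Sym2.mem_map.2 ⟨v, hv, rfl⟩) (Sym2.mem_map.2 ⟨v, hv', rfl⟩)
    · rw [← hc, Finset.card_preimage]
      congr 1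
      exact Finset.filter_true_of_mem fun e he => hval e he

theorem mem_matchingFreeComplex_iff :
    F ∈ G.matchingFreeComplex q ↔ ¬ G.HasMatchingWithin F q :=
  not_congr hasMatchingOfSize_induce_iff

theorem HasMatchingWithin.mono (hF : F ⊆ F') (h : G.HasMatchingWithin F q) :
    G.HasMatchingWithin F' q :=
  h.map Hom.id Function.injective_id (fun _ hv => hF hv)

theorem HasMatchingWithin.mono_size (hr : r ≤ q) (h : G.HasMatchingWithin F q) :
    G.HasMatchingWithin F r := by
  obtain ⟨M, ⟨hE, hD⟩, hin, hc⟩ := h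
  obtain ⟨M', hM', hc'⟩ := Finset.exists_subset_card_eq (hc ▸ hr)
  exact ⟨M', ⟨fun e he => hE e (hM' he), fun e he f hf => hD e (hM' he) f (hM' hf)⟩,
    fun e he => hin e (hM' he), hc'⟩

theorem hasMatchingWithin_zero : G.HasMatchingWithin F 0 :=
  ⟨∅, ⟨by simp, by simp⟩, by simp, rfl⟩

theorem HasMatchingWithin.insert_edge {u v : V} (hu : u ∈ F) (hv : v ∈ F) (huv : G.Adj u v)
    (hu' : u ∉ F') (hv' : v ∉ F') (hF : F' ⊆ F) (h : G.HasMatchingWithin F' q) :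
    G.HasMatchingWithin F (q + 1) := by
  classical
  obtain ⟨M, ⟨hE, hD⟩, hin, hc⟩ := h
  have hdis : ∀ e ∈ M, ∀ w ∈ e, w ∉ s(u, v) := by
    intro e he w hw hw'
    rcases Sym2.mem_iff.1 hw' with rfl | rfl
    · exact hu' (hin e he _ hw)
    · exact hv' (hin e he _ hw)
  have hnot : s(u, v) ∉ M := fun hm => hu' (hin _ hm u (by simp))
  refine ⟨insert s(u, v) M, ⟨?_, ?_⟩, ?_, by rw [Finset.card_insert_of_notMem hnot, hc]⟩
  · intro e he
    rcases Finset.mem_insert.1 he with rfl | he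
    · exact huv
    · exact hE e he
  · intro e he f hf hne w hw hw'
    rcases Finset.mem_insert.1 he with rfl | he <;> rcases Finset.mem_insert.1 hf with rfl | hf
    · exact hne rfl
    · exact hdis f hf w hw' hw
    · exact hdis e he w hw hw'
    · exact hD e he f hf hne w hw hw'
  · intro e he w hw
    rcases Finset.mem_insert.1 he with rfl | he
    · rcases Sym2.mem_iff.1 hw with rfl | rfl <;> assumption
    · exact hF (hin e he w hw)

theorem HasMatchingWithin.le_card_of_covers (h : G.HasMatchingWithin F q)
    (hK : G.CoversWithin F K) : q ≤ K.card := by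
  classical
  obtain ⟨M, ⟨hE, hD⟩, hin, hc⟩ := h
  have hex : ∀ e ∈ M, ∃ v ∈ K, v ∈ e := by
    intro e he
    have hadj := hE e he
    have hmem := hin e he
    induction e with
    | h a b =>
      rcases hK a (hmem a (by simp)) b (hmem b (by simp)) hadj with h | h
      · exact ⟨a, h, by simp⟩
      · exact ⟨b, h, by simp⟩
  choose f hfK hfe using hex
  rw [← hc, ← M.card_attach]
  refine Finset.card_le_card_of_injOn (fun e => f e.1 e.2) (fun e _ => hfK e.1 e.2) ?_
  intro e _ e' _ hee
  by_contra hne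
  have hee' : f e.1 e.2 = f e'.1 e'.2 := hee
  exact hD e e.2 e' e'.2 (fun h => hne (Subtype.ext h)) _ (hfe e.1 e.2) (hee' ▸ hfe e'.1 e'.2)

theorem HasMatchingWithin.restrict (h : G.HasMatchingWithin F q)
    (hF : ∀ u ∈ F, ∀ v ∈ F, G.Adj u v → u ∈ F') : G.HasMatchingWithin F' q := by
  obtain ⟨M, ⟨hE, hD⟩, hin, hc⟩ := h
  refine ⟨M, ⟨hE, hD⟩, ?_, hc⟩
  intro e he v hv
  have hadj := hE e he
  have hmem := hin e he
  induction e with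
  | h a b =>
    have ha := hmem a (by simp)
    have hb := hmem b (by simp)
    rcases Sym2.mem_iff.1 hv with rfl | rfl
    · exact hF _ ha _ hb hadj
    · exact hF _ hb _ ha (G.adj_symm hadj)

theorem HasMatchingWithin.two_mul_le_card (h : G.HasMatchingWithin F q) : 2 * q ≤ F.card := by
  classical
  obtain ⟨M, ⟨hE, hD⟩, hin, hc⟩ := h
  have hcard : (M.biUnion Sym2.toFinset).card = 2 * q := by
    rw [Finset.card_biUnion]
    · rw [Finset.sum_congr rfl (fun e he =>
        Sym2.card_toFinset_of_not_isDiag e (G.not_isDiag_of_mem_edgeSet (hE e he)))]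
      simp [hc, mul_comm]
    · intro e he f hf hne
      refine Finset.disjoint_left.2 ?_
      intro v hv hv'
      exact hD e he f hf hne v (Sym2.mem_toFinset.1 hv) (Sym2.mem_toFinset.1 hv')
  rw [← hcard]
  refine Finset.card_le_card fun v hv => ?_
  obtain ⟨e, he, hve⟩ := Finset.mem_biUnion.1 hv
  exact hin e he v (Sym2.mem_toFinset.1 hve)

theorem SparseOn.mono (h : G.SparseOn F') (hF : F ⊆ F') : G.SparseOn F :=
  fun T hT => h T (hT.trans hF)

/-- Kőnig's theorem for sparse sets. -/
theorem SparseOn.exists_covers_hasMatchingWithin (h : G.SparseOn F) :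
    ∃ K ⊆ F, G.CoversWithin F K ∧ G.HasMatchingWithin F K.card := by
  classical
  induction F using Finset.strongInduction with
  | H F ih =>
    rcases F.eq_empty_or_nonempty with rfl | hne
    · exact ⟨∅, by simp, by simp [CoversWithin], hasMatchingWithin_zero⟩
    obtain ⟨v, hv, hv1⟩ := h F subset_rfl hne
    by_cases hex : ∃ u ∈ F, G.Adj v u
    · obtain ⟨u, hu, huv⟩ := hex
      have hss : (F.erase v).erase u ⊂ F :=
        (Finset.erase_subset _ _).trans_ssubset (Finset.erase_ssubset hv)
      obtain ⟨K, hKF, hK, hM⟩ := ih _ hss (h.mono hss.subset)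
      have huK : u ∉ K := fun hh => by simpa using hKF hh
      -- As `v` is a leaf with neighbour `u`, putting `u` in the cover takes care of all edges at
      -- `v` and `u`, and the edge `vu` enlarges the matching.
      refine ⟨insert u K, Finset.insert_subset hu (hKF.trans hss.subset), ?_, ?_⟩
      · intro a ha b hb hab
        simp only [Finset.mem_insert]
        by_cases hau : a = u
        · exact .inl (.inl hau)
        by_cases hbu : b = u
        · exact .inr (.inl hbu)
        have hav : a ≠ v := by
          rintro rfl
          exact hbu (hv1 b hb u hu hab huv)
        have hbv : b ≠ v := by
          rintro rfl
          exact hau (hv1 a ha u hu hab.symm huv)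
        exact (hK a (by simp [*]) b (by simp [*]) hab).imp .inr .inr
      · rw [Finset.card_insert_of_notMem huK]
        exact hM.insert_edge hv hu huv (by simp) (by simp) hss.subset
    · push Not at hex
      have hss := Finset.erase_ssubset hv
      obtain ⟨K, hKF, hK, hM⟩ := ih _ hss (h.mono hss.subset)
      refine ⟨K, hKF.trans hss.subset, ?_, hM.mono hss.subset⟩
      intro a ha b hb hab
      have hav : a ≠ v := by
        rintro rfl
        exact hex b hb hab
      have hbv : b ≠ v := by
        rintro rfl
        exact hex a ha hab.symm
      exact hK a (by simp [*]) b (by simp [*]) hab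

/-- A sparse set has an elimination order: each vertex has at most one smaller neighbour. -/
theorem SparseOn.exists_order [Finite V] (h : G.SparseOn F) :
    ∃ p : V → ℕ, Function.Injective p ∧ ∀ v ∈ F, ∀ u ∈ F, ∀ u' ∈ F, G.Adj v u → G.Adj v u' →
      p u < p v → p u' < p v → u = u' := by
  classical
  have := Fintype.ofFinite V
  induction F using Finset.strongInduction with
  | H F ih =>
    rcases F.eq_empty_or_nonempty with rfl | hne
    · exact ⟨fun v => Fintype.equivFin V v, fun a b hab => by
        simpa [Fin.val_inj] using hab, by simp⟩
    obtain ⟨v, hv, hv1⟩ := h F subset_rfl hne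
    have hss := Finset.erase_ssubset hv
    obtain ⟨p, hp, hp1⟩ := ih _ hss (h.mono hss.subset)
    have hlt : ∀ u, p u < Finset.univ.sup p + 1 := fun u =>
      Nat.lt_succ_of_le (Finset.le_sup (Finset.mem_univ u))
    -- The vertex `v` of degree at most one is placed last, above every value of `p`.
    refine ⟨Function.update p v (Finset.univ.sup p + 1), ?_, ?_⟩
    · intro a b hab
      by_cases ha : a = v <;> by_cases hb : b = v
      · exact ha.trans hb.symm
      · subst ha
        rw [Function.update_self, Function.update_of_ne hb] at hab
        exact absurd hab (hlt b).ne'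
      · subst hb
        rw [Function.update_self, Function.update_of_ne ha] at hab
        exact absurd hab (hlt a).ne
      · rw [Function.update_of_ne ha, Function.update_of_ne hb] at hab
        exact hp hab
    · intro a ha u hu u' hu' hau hau' h1 h2
      by_cases hav : a = v
      · subst hav
        exact hv1 u hu u' hu' hau hau'
      have key : ∀ x, Function.update p v (Finset.univ.sup p + 1) x <
          Function.update p v (Finset.univ.sup p + 1) a → x ≠ v ∧ p x < p a := by
        intro x hx
        rw [Function.update_of_ne hav] at hx
        by_cases hxv : x = v
        · subst hxv
          rw [Function.update_self] at hx
          exact absurd hx (hlt a).not_gt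
        · rw [Function.update_of_ne hxv] at hx
          exact ⟨hxv, hx⟩
      obtain ⟨hu1, hu2⟩ := key u h1
      obtain ⟨hu1', hu2'⟩ := key u' h2
      exact hp1 a (by simp [*]) u (by simp [*]) u' (by simp [*]) hau hau' hu2 hu2'

end Matching

/-! ### Cycles: existence, matchings and covers -/

section Cycle

variable {V : Type*} {G : SimpleGraph V}

/-- The start of a longest path has all its neighbours on the path, and in an acyclic graph such a
neighbour can only be the second vertex. -/
theorem IsAcyclic.exists_forall_adj_eq [Finite V] [Nonempty V] (h : G.IsAcyclic) :
    ∃ v, ∀ u u', G.Adj v u → G.Adj v u' → u = u' := by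
  classical
  have := Fintype.ofFinite V
  let P : ℕ → Prop := fun n => ∃ (u v : V) (p : G.Walk u v), p.IsPath ∧ p.length = n
  have hP0 : P 0 := ⟨Classical.arbitrary V, _, .nil, .nil, rfl⟩
  obtain ⟨u, v, p, hp, hlen⟩ := Nat.findGreatest_spec (Nat.zero_le (Fintype.card V)) hP0
  have hsupp : ∀ w, G.Adj u w → w ∈ p.support := by
    intro w hw
    by_contra hws
    have hq : (Walk.cons hw.symm p).IsPath := hp.cons hws
    have : (Walk.cons hw.symm p).length ≤ Nat.findGreatest P (Fintype.card V) :=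
      Nat.le_findGreatest hq.length_lt.le ⟨_, _, _, hq, rfl⟩
    rw [Walk.length_cons] at this
    omega
  exact ⟨u, fun x y hx hy => (h.eq_snd_of_adj_start hp hx (hsupp x hx)).trans
    (h.eq_snd_of_adj_start hp hy (hsupp y hy)).symm⟩

/-- `C` is the vertex set of a cycle of `G`. -/
def IsCycleSet (G : SimpleGraph V) (C : Finset V) : Prop :=
  ∃ (a : V) (w : G.Walk a a), w.IsCycle ∧ ∀ v, v ∈ C ↔ v ∈ w.support

variable {C S K : Finset V}

theorem exists_isCycleSet_of_not_sparseOn (h : ¬ G.SparseOn S) : ∃ C ⊆ S, G.IsCycleSet C := by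
  classical
  simp only [SparseOn] at h
  push Not at h
  obtain ⟨T, hTS, hT, hdeg⟩ := h
  have : Nonempty (T : Set V) := ⟨⟨_, hT.choose_spec⟩⟩
  have hac : ¬ (G.induce (T : Set V)).IsAcyclic := by
    intro hac
    obtain ⟨v, hv⟩ := hac.exists_forall_adj_eq
    obtain ⟨u, hu, u', hu', hvu, hvu', hne⟩ := hdeg v v.2
    exact hne (congrArg Subtype.val (hv ⟨u, hu⟩ ⟨u', hu'⟩ hvu hvu'))
  simp only [IsAcyclic] at hac
  push Not at hac
  obtain ⟨a, w, hw⟩ := hac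
  have hw' := hw.map (f := (Embedding.induce (G := G) (T : Set V)).toHom) Subtype.val_injective
  refine ⟨(w.map (Embedding.induce (G := G) (T : Set V)).toHom).support.toFinset, ?_,
    _, _, hw', fun v => List.mem_toFinset⟩
  intro v hv
  rw [List.mem_toFinset, Walk.support_map, List.mem_map] at hv
  obtain ⟨x, -, rfl⟩ := hv
  exact hTS x.2

/-- Rotate the cycle to start at `c` and drop its first edge; the remaining path still visits every
vertex. -/
theorem IsCycleSet.exists_isPath (h : G.IsCycleSet C) {c : V} (hc : c ∈ C) :
    ∃ (d : V) (p : G.Walk d c), G.Adj c d ∧ p.IsPath ∧ (∀ v, v ∈ C ↔ v ∈ p.support) := by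
  classical
  obtain ⟨a, w, hw, hC⟩ := h
  have hcw := (hC c).1 hc
  have hcyc := hw.rotate hcw
  have hmem := fun v => (hC v).trans (w.mem_support_rotate_iff (w := v) c hcw).symm
  generalize w.rotate c hcw = w' at hcyc hmem
  cases w' with
  | nil => exact absurd hcyc Walk.not_isCycle_nil
  | cons h p =>
    refine ⟨_, p, h, ((Walk.cons_isCycle_iff _ _).1 hcyc).1, fun v => (hmem v).trans ?_⟩
    rw [Walk.support_cons, List.mem_cons, or_iff_right_of_imp]
    rintro rfl
    exact p.end_mem_support

theorem IsCycleSet.nonempty (h : G.IsCycleSet C) : C.Nonempty := by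
  obtain ⟨a, w, -, hC⟩ := h
  exact ⟨a, (hC a).2 w.start_mem_support⟩

theorem IsCycleSet.exists_adj (h : G.IsCycleSet C) {c : V} (hc : c ∈ C) :
    ∃ d ∈ C, G.Adj c d := by
  obtain ⟨d, p, hd, -, hC⟩ := h.exists_isPath hc
  exact ⟨d, (hC d).2 p.start_mem_support, hd⟩

theorem Walk.IsPath.card_eq [DecidableEq V] {u v : V} {p : G.Walk u v} (hp : p.IsPath) :
    p.support.toFinset.card = p.length + 1 := by
  rw [List.toFinset_card_of_nodup hp.support_nodup, Walk.length_support]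

/-- Take every other edge, starting with the first. -/
theorem Walk.IsPath.hasMatchingWithin [DecidableEq V] {u v : V} {p : G.Walk u v} (hp : p.IsPath) :
    G.HasMatchingWithin p.support.toFinset ((p.length + 1) / 2) := by
  match p, hp with
  | .nil, _ => simpa using hasMatchingWithin_zero
  | .cons h .nil, hp =>
    have h1 : G.HasMatchingWithin (Walk.cons h .nil).support.toFinset (0 + 1) :=
      hasMatchingWithin_zero.insert_edge (List.mem_toFinset.2 (Walk.start_mem_support _))
        (List.mem_toFinset.2 (Walk.end_mem_support _)) h (Finset.notMem_empty _)
        (Finset.notMem_empty _) (Finset.empty_subset _)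
    simpa only [Walk.length_cons, Walk.length_nil, zero_add, Nat.reduceAdd, Nat.reduceDiv] using h1
  | .cons h (.cons h' r), hp =>
    have hp1 := (Walk.cons_isPath_iff _ _).1 hp
    have hp2 := (Walk.cons_isPath_iff _ _).1 hp1.1
    have ih := hp2.1.hasMatchingWithin
    have hlen : ((Walk.cons h (Walk.cons h' r)).length + 1) / 2 = (r.length + 1) / 2 + 1 := by
      simp only [Walk.length_cons]
      omega
    rw [hlen]
    refine ih.insert_edge (by simp) (by simp) h ?_ ?_ ?_
    · have := hp1.2
      simp only [Walk.support_cons, List.mem_cons, not_or] at this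
      simpa using this.2
    · simpa using hp2.2
    · intro x hx
      simp only [List.mem_toFinset, Walk.support_cons, List.mem_cons] at hx ⊢
      exact .inr (.inr hx)
  termination_by p.length

theorem IsCycleSet.card_eq {a : V} {w : G.Walk a a} (hw : w.IsCycle)
    (hC : ∀ v, v ∈ C ↔ v ∈ w.support) : C.card = w.length := by
  classical
  cases w with
  | nil => exact absurd hw Walk.not_isCycle_nil
  | cons h p =>
    have hp := ((Walk.cons_isCycle_iff _ _).1 hw).1
    rw [Walk.length_cons, ← hp.card_eq]
    congr 1
    ext v
    rw [hC, List.mem_toFinset, Walk.support_cons, List.mem_cons, or_iff_right_of_imp]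
    rintro rfl
    exact p.end_mem_support

theorem IsCycleSet.hasMatchingWithin (h : G.IsCycleSet C) :
    G.HasMatchingWithin C (C.card / 2) := by
  classical
  obtain ⟨c, hc⟩ := h.nonempty
  obtain ⟨d, p, hd, hp, hC⟩ := h.exists_isPath hc
  have hCe : C = p.support.toFinset := by ext v; rw [hC, List.mem_toFinset]
  rw [hCe, hp.card_eq]
  exact hp.hasMatchingWithin

theorem IsCycleSet.hasMatchingWithin_erase [DecidableEq V] (h : G.IsCycleSet C) {c : V}
    (hc : c ∈ C) : G.HasMatchingWithin (C.erase c) ((C.card - 1) / 2) := by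
  obtain ⟨d, p, hd, hp, hC⟩ := h.exists_isPath hc
  have hr := hp.reverse
  have hCr : ∀ v, v ∈ C ↔ v ∈ p.reverse.support := by simpa using hC
  have hCe : C = p.reverse.support.toFinset := by ext v; rw [hCr, List.mem_toFinset]
  generalize p.reverse = r at hr hCr hCe
  cases r with
  | nil => exact absurd hd G.irrefl
  | cons h r =>
    obtain ⟨hr1, hr2⟩ := (Walk.cons_isPath_iff _ _).1 hr
    have hcard : (C.card - 1) / 2 = (r.length + 1) / 2 := by
      rw [hCe, hr.card_eq, Walk.length_cons]
      omega
    rw [hcard]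
    refine hr1.hasMatchingWithin.mono fun v hv => ?_
    rw [List.mem_toFinset] at hv
    refine Finset.mem_erase.2 ⟨fun hvc => hr2 (hvc ▸ hv), (hCr v).2 ?_⟩
    rw [Walk.support_cons]
    exact List.mem_cons_of_mem _ hv

/-- A set of fewer than `|C| / 2` vertices does not cover the edges of the cycle `C`. -/
theorem IsCycleSet.card_le_of_covers (h : G.IsCycleSet C) (hK : G.CoversWithin C K) :
    C.card ≤ 2 * K.card := by
  classical
  have h1 := h.hasMatchingWithin.le_card_of_covers hK
  -- The matching bound `h1` loses one when `|C|` is odd. Deleting a vertex of the cover from the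
  -- cycle leaves a path covered by the rest of `K`, which recovers it.
  obtain ⟨c, hc, hcK⟩ : ∃ c ∈ C, c ∈ K := by
    obtain ⟨c, hc⟩ := h.nonempty
    obtain ⟨d, hd, hcd⟩ := h.exists_adj hc
    rcases hK c hc d hd hcd with hk | hk
    exacts [⟨c, hc, hk⟩, ⟨d, hd, hk⟩]
  have h2 := (h.hasMatchingWithin_erase hc).le_card_of_covers (K := K.erase c) (by
    intro u hu v hv huv
    rw [Finset.mem_erase] at hu hv
    rcases hK u hu.2 v hv.2 huv with hk | hk
    · exact .inl (Finset.mem_erase.2 ⟨hu.1, hk⟩)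
    · exact .inr (Finset.mem_erase.2 ⟨hv.1, hk⟩))
  rw [Finset.card_erase_of_mem hcK] at h2
  have := Finset.card_pos.2 ⟨c, hcK⟩
  omega

end Cycle

/-! ### From `H` to its whisker graph -/

section WhiskerTransfer

variable {V : Type*} {H : SimpleGraph V} {F : Finset (V ⊕ V)} {C : Finset V}

/-- A whisker end has at most one neighbour; a subset without whisker ends lies in `H`. -/
theorem SparseOn.whisker (h : H.SparseOn F.toLeft) : H.whisker.SparseOn F := by
  intro T hT hne
  by_cases hr : ∃ i, Sum.inr i ∈ T
  · obtain ⟨i, hi⟩ := hr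
    refine ⟨_, hi, ?_⟩
    rintro (u | u) - (v | v) - hu hv
    · obtain rfl : i = u := hu
      obtain rfl : i = v := hv
      rfl
    · exact hv.elim
    · exact hu.elim
    · exact hu.elim
  · push Not at hr
    obtain ⟨v, hv, hv1⟩ := h T.toLeft (Finset.toLeft_subset_toLeft hT) (by
      obtain ⟨(i | i), hi⟩ := hne
      · exact ⟨i, Finset.mem_toLeft.2 hi⟩
      · exact absurd hi (hr i))
    refine ⟨_, Finset.mem_toLeft.1 hv, ?_⟩
    rintro (a | a) ha (b | b) hb hva hvb
    · exact congrArg _ (hv1 a (Finset.mem_toLeft.2 ha) b (Finset.mem_toLeft.2 hb) hva hvb)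
    · exact absurd hb (hr b)
    · exact absurd ha (hr a)
    · exact absurd ha (hr a)

theorem HasMatchingWithin.whisker {r : ℕ} (h : H.HasMatchingWithin C r) :
    H.whisker.HasMatchingWithin (C.map ⟨Sum.inl, Sum.inl_injective⟩) r :=
  h.map (⟨Sum.inl, fun h => h⟩ : H →g H.whisker) Sum.inl_injective
    fun v hv => Finset.mem_map.2 ⟨v, hv, rfl⟩

end WhiskerTransfer

/-! ### The facets of the matching-free complex -/

section Whisker

variable {V : Type*} [Fintype V] [DecidableEq V] {H : SimpleGraph V} {q r : ℕ}
  {C D S : Finset V} {F : Finset (V ⊕ V)} {x y : Finset V × Finset V}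

/-- The set of vertices of a whisker graph whose complement consists of the vertices of `H` in
`x.1` and the whisker ends at the vertices in `x.2`. -/
def whiskerCompl (x : Finset V × Finset V) : Finset (V ⊕ V) :=
  x.1ᶜ.disjSum x.2ᶜ

@[simp] theorem inl_mem_whiskerCompl {i : V} : Sum.inl i ∈ whiskerCompl x ↔ i ∉ x.1 := by
  simp [whiskerCompl]

@[simp] theorem inr_mem_whiskerCompl {i : V} : Sum.inr i ∈ whiskerCompl x ↔ i ∉ x.2 := by
  simp [whiskerCompl]

theorem subset_whiskerCompl_iff : F ⊆ whiskerCompl x ↔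
    (∀ i ∈ x.1, Sum.inl i ∉ F) ∧ ∀ i ∈ x.2, Sum.inr i ∉ F := by
  constructor
  · intro h
    exact ⟨fun i hi hF => inl_mem_whiskerCompl.1 (h hF) hi,
      fun i hi hF => inr_mem_whiskerCompl.1 (h hF) hi⟩
  · rintro ⟨h1, h2⟩ (i | i) hi
    · exact inl_mem_whiskerCompl.2 fun hx => h1 i hx hi
    · exact inr_mem_whiskerCompl.2 fun hx => h2 i hx hi

theorem whiskerCompl_subset_iff :
    whiskerCompl x ⊆ whiskerCompl y ↔ y.1 ⊆ x.1 ∧ y.2 ⊆ x.2 := by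
  rw [subset_whiskerCompl_iff]
  simp [Finset.subset_iff]

/-- The pairs describing the facets of `MF^q(W(H))` that have a vertex cover of size `q - 1`,
where `r = |V| + 1 - q`. -/
structure IsCoverPair (H : SimpleGraph V) (r : ℕ) (x : Finset V × Finset V) : Prop where
  disjoint : Disjoint x.1 x.2
  not_adj : ∀ u ∈ x.2, ∀ v ∈ x.2, ¬ H.Adj u v
  card_add : x.1.card + x.2.card = r

/-- The pairs describing the facets of `MF^q(W(H))` that contain an odd cycle. -/
def IsCyclePair (H : SimpleGraph V) (q : ℕ) (x : Finset V × Finset V) : Prop :=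
  ∃ C D : Finset V, H.IsCycleSet C ∧ C.card = 2 * q - 1 ∧
    (∀ u ∈ D, ∀ v ∈ C ∪ D, ¬ H.Adj u v) ∧ x = ((C ∪ D)ᶜ, C ∪ D)

/-- An edge of `H` in the set avoids `x.1` and cannot have both ends in the independent set `x.2`; a
whisker in the set has its index outside both. -/
theorem IsCoverPair.coversWithin_whisker (hx : H.IsCoverPair r x) :
    H.whisker.CoversWithin (whiskerCompl x) ((x.1 ∪ x.2)ᶜ.map ⟨Sum.inl, Sum.inl_injective⟩) := by
  have hd := hx.not_adj
  rintro (u | u) hu (v | v) hv huv <;>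
    simp only [inl_mem_whiskerCompl, inr_mem_whiskerCompl] at hu hv
  · simp only [Finset.mem_map, Finset.mem_compl, Finset.mem_union, Function.Embedding.coeFn_mk,
      Sum.inl.injEq, exists_eq_right, hu, hv, false_or]
    by_contra! hcon
    exact hd u hcon.1 v hcon.2 huv
  · obtain rfl : u = v := huv
    simp [hu, hv]
  · obtain rfl : u = v := huv
    simp [hu, hv]
  · exact huv.elim

theorem IsCoverPair.card_compl (hx : H.IsCoverPair r x) :
    (x.1 ∪ x.2)ᶜ.card = Fintype.card V - r := by
  rw [Finset.card_compl, Finset.card_union_of_disjoint hx.disjoint, hx.card_add]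

theorem IsCoverPair.mem_matchingFreeComplex (hq : 1 ≤ q)
    (hx : H.IsCoverPair (Fintype.card V + 1 - q) x) :
    whiskerCompl x ∈ H.whisker.matchingFreeComplex q := by
  rw [mem_matchingFreeComplex_iff]
  intro h
  have := h.le_card_of_covers hx.coversWithin_whisker
  rw [Finset.card_map, hx.card_compl] at this
  -- The cover has at most `q - 1` vertices, also when `|V| + 1 - q` truncates to 0.
  omega

/-- Such a cycle would be covered by at most q - 1 vertices, hence have at most 2q - 2 vertices. -/
theorem IsCoverPair.not_isCycleSet (hq : 1 ≤ q) (hx : H.IsCoverPair (Fintype.card V + 1 - q) x)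
    (hcyc : ∀ C, H.IsCycleSet C → 2 * q - 1 ≤ C.card) (hC : C ⊆ x.1ᶜ) : ¬ H.IsCycleSet C := by
  intro h
  have hK : H.CoversWithin C (x.1 ∪ x.2)ᶜ := by
    intro u hu v hv huv
    have hu' := Finset.mem_compl.1 (hC hu)
    have hv' := Finset.mem_compl.1 (hC hv)
    simp only [Finset.mem_compl, Finset.mem_union, hu', hv', false_or]
    by_contra! hcon
    exact hx.not_adj u hcon.1 v hcon.2 huv
  have h1 := h.card_le_of_covers hK
  have h2 := hcyc C h
  rw [hx.card_compl] at h1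
  omega

theorem IsCoverPair.sparseOn (hq : 1 ≤ q) (hx : H.IsCoverPair (Fintype.card V + 1 - q) x)
    (hcyc : ∀ C, H.IsCycleSet C → 2 * q - 1 ≤ C.card) : H.SparseOn x.1ᶜ := by
  by_contra h
  obtain ⟨C, hC, hCc⟩ := exists_isCycleSet_of_not_sparseOn h
  exact hx.not_isCycleSet hq hcyc hC hCc

theorem exists_isCoverPair_of_sparseOn (hF : ¬ H.whisker.HasMatchingWithin F q)
    (h : H.SparseOn F.toLeft) :
    ∃ x, H.IsCoverPair (Fintype.card V + 1 - q) x ∧ F ⊆ whiskerCompl x := by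
  obtain ⟨K, -, hK, hM⟩ := h.whisker.exists_covers_hasMatchingWithin
  have hKq : K.card < q := by
    by_contra hcon
    exact hF (hM.mono_size (not_lt.1 hcon))
  -- `D` is independent, since `K` is a cover. An index outside `A ∪ B` has one of its two vertices
  -- in `K`, so at most `|K|` indices are lost.
  set D : Finset V := {i | Sum.inl i ∈ F ∧ Sum.inl i ∉ K} with hD
  set A : Finset V := {i | i ∉ D ∧ Sum.inl i ∉ K} with hA
  set B : Finset V := {i | i ∈ D ∧ Sum.inr i ∉ K} with hB
  have hAB : Disjoint A B := by
    rw [Finset.disjoint_left]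
    intro i hiA hiB
    exact (Finset.mem_filter.1 hiA).2.1 (Finset.mem_filter.1 hiB).2.1
  have hcard : (A ∪ B)ᶜ.card ≤ K.card := by
    refine Finset.card_le_card_of_injOn (fun i => if i ∈ D then Sum.inr i else Sum.inl i) ?_ ?_
    · intro i hi
      have hi' : i ∉ A ∧ i ∉ B := by simpa using hi
      simp only [hA, hB, Finset.mem_filter, Finset.mem_univ, true_and, not_and, not_not] at hi'
      by_cases hiD : i ∈ D
      · simpa [hiD] using hi'.2 hiD
      · simpa [hiD] using hi'.1 hiD
    · intro i _ j _ hij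
      by_cases hi : i ∈ D <;> by_cases hj : j ∈ D <;> simp [hi, hj] at hij <;> exact hij
  -- `A ∪ B` may be too large; shrinking it to the exact size only enlarges the facet.
  obtain ⟨U, hU, hUc⟩ : ∃ U ⊆ A ∪ B, U.card = Fintype.card V + 1 - q := by
    apply Finset.exists_subset_card_eq
    rw [Finset.card_compl] at hcard
    omega
  refine ⟨(A ∩ U, B ∩ U), ⟨?_, ?_, ?_⟩, ?_⟩
  · exact hAB.mono Finset.inter_subset_left Finset.inter_subset_left
  · intro u hu v hv huv
    have hu1 := (Finset.mem_filter.1 (Finset.mem_filter.1 (Finset.mem_inter.1 hu).1).2.1).2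
    have hv1 := (Finset.mem_filter.1 (Finset.mem_filter.1 (Finset.mem_inter.1 hv).1).2.1).2
    exact (hK _ hu1.1 _ hv1.1 huv).elim hu1.2 hv1.2
  · rw [← Finset.card_union_of_disjoint
      (hAB.mono Finset.inter_subset_left Finset.inter_subset_left), ← Finset.union_inter_distrib_right,
      Finset.inter_eq_right.2 hU, hUc]
  · rw [subset_whiskerCompl_iff]
    constructor
    · intro i hi hiF
      have h1 := (Finset.mem_filter.1 (Finset.mem_inter.1 hi).1).2
      exact h1.1 (Finset.mem_filter.2 ⟨Finset.mem_univ _, hiF, h1.2⟩)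
    · intro i hi hiF
      have h1 := (Finset.mem_filter.1 (Finset.mem_inter.1 hi).1).2
      have h2 := (Finset.mem_filter.1 h1.1).2
      exact (hK (Sum.inl i) h2.1 (Sum.inr i) hiF rfl).elim h2.2 h1.2

theorem exists_isCyclePair_of_not_sparseOn (hF : ¬ H.whisker.HasMatchingWithin F q)
    (hcyc : ∀ C, H.IsCycleSet C → 2 * q - 1 ≤ C.card) (h : ¬ H.SparseOn F.toLeft) :
    ∃ x, H.IsCyclePair q x ∧ F ⊆ whiskerCompl x := by
  obtain ⟨C, hCF, hC⟩ := exists_isCycleSet_of_not_sparseOn h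
  have hCF' : C.map ⟨Sum.inl, Sum.inl_injective⟩ ⊆ F := by
    intro v hv
    obtain ⟨i, hi, rfl⟩ := Finset.mem_map.1 hv
    exact Finset.mem_toLeft.1 (hCF hi)
  have hlt : C.card / 2 < q := by
    by_contra hcon
    exact hF ((hC.hasMatchingWithin.whisker.mono hCF').mono_size (not_lt.1 hcon))
  have hge := hcyc C hC
  have hcard : C.card = 2 * q - 1 := by omega
  -- An edge leaving `C` meets it in at most one vertex `c`; adding the edge to a matching of size q
  -- - 1 in `C` minus `c` would give size q.
  have hiso : ∀ a ∈ F, (∀ i ∈ C, a ≠ Sum.inl i) → ∀ b ∈ F, ¬ H.whisker.Adj a b := by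
    intro a ha haC b hb hab
    obtain ⟨c, hc, hbc⟩ : ∃ c ∈ C, ∀ i ∈ C.erase c, b ≠ Sum.inl i := by
      by_cases hbC : ∃ c ∈ C, b = Sum.inl c
      · obtain ⟨c, hc, rfl⟩ := hbC
        exact ⟨c, hc, fun i hi h => (Finset.mem_erase.1 hi).1 (Sum.inl_injective h).symm⟩
      · push Not at hbC
        obtain ⟨c, hc⟩ := hC.nonempty
        exact ⟨c, hc, fun i hi => hbC i (Finset.mem_of_mem_erase hi)⟩
    refine hF ?_
    have hm := (hC.hasMatchingWithin_erase hc).whisker.insert_edge ha hb hab ?_ ?_ ?_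
    · exact hm.mono_size (by omega)
    · intro h
      obtain ⟨i, hi, rfl⟩ := Finset.mem_map.1 h
      exact haC i (Finset.mem_of_mem_erase hi) rfl
    · intro h
      obtain ⟨i, hi, rfl⟩ := Finset.mem_map.1 h
      exact hbc i hi rfl
    · exact (Finset.map_subset_map.2 (Finset.erase_subset _ _)).trans hCF'
  have hCD : C ∪ F.toLeft \ C = F.toLeft := Finset.union_sdiff_of_subset hCF
  refine ⟨_, ⟨C, F.toLeft \ C, hC, hcard, ?_, rfl⟩, ?_⟩
  · intro u hu v hv huv
    rw [hCD] at hv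
    rw [Finset.mem_sdiff] at hu
    exact hiso (Sum.inl u) (Finset.mem_toLeft.1 hu.1)
      (fun i hi h => hu.2 (Sum.inl_injective h ▸ hi)) (Sum.inl v) (Finset.mem_toLeft.1 hv) huv
  · rw [hCD, subset_whiskerCompl_iff]
    constructor
    · intro i hi hiF
      exact Finset.mem_compl.1 hi (Finset.mem_toLeft.2 hiF)
    · intro i hi hiF
      exact hiso (Sum.inr i) hiF (fun _ _ => Sum.inr_ne_inl) (Sum.inl i) (Finset.mem_toLeft.1 hi)
        rfl

/-- All edges lie inside `C`, whose 2q - 1 vertices are too few for q disjoint edges. -/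
theorem IsCyclePair.mem_matchingFreeComplex (hq : 1 ≤ q) (hx : H.IsCyclePair q x) :
    whiskerCompl x ∈ H.whisker.matchingFreeComplex q := by
  obtain ⟨C, D, hC, hcard, hD, rfl⟩ := hx
  rw [mem_matchingFreeComplex_iff]
  intro h
  have h1 := (h.restrict (F' := C.map ⟨Sum.inl, Sum.inl_injective⟩) ?_).two_mul_le_card
  · rw [Finset.card_map] at h1
    omega
  · rintro (u | u) hu (v | v) hv huv <;>
      simp only [inl_mem_whiskerCompl, inr_mem_whiskerCompl, Finset.mem_compl, not_not] at hu hv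
    · refine Finset.mem_map.2 ⟨u, ?_, rfl⟩
      by_contra huC
      exact hD u ((Finset.mem_union.1 hu).resolve_left huC) v hv huv
    · obtain rfl : u = v := huv
      exact absurd hu hv
    · obtain rfl : u = v := huv
      exact absurd hv hu
    · exact huv.elim

/-- The pairs describing the facets of `MF^q(W(H))`. -/
def whiskerFacetPairs (H : SimpleGraph V) (q : ℕ) : Set (Finset V × Finset V) :=
  {x | H.IsCoverPair (Fintype.card V + 1 - q) x ∨ H.IsCyclePair q x}

/-- Cover pairs have equal size, and a cycle pair is determined by `C ∪ D`. In the mixed cases a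
cycle would sit in the independent set of a cover pair, or outside its first component. -/
theorem whiskerFacetPairs_antichain (hq : 1 ≤ q)
    (hcyc : ∀ C, H.IsCycleSet C → 2 * q - 1 ≤ C.card) (hx : x ∈ H.whiskerFacetPairs q)
    (hy : y ∈ H.whiskerFacetPairs q) (h1 : y.1 ⊆ x.1) (h2 : y.2 ⊆ x.2) : x = y := by
  rcases hx with hx | hx <;> rcases hy with hy | hy
  · have c1 := Finset.card_le_card h1
    have c2 := Finset.card_le_card h2
    have c3 := hx.card_add
    have c4 := hy.card_add
    exact Prod.ext (Finset.eq_of_subset_of_card_le h1 (by omega)).symm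
      (Finset.eq_of_subset_of_card_le h2 (by omega)).symm
  · obtain ⟨C, D, hC, -, -, rfl⟩ := hy
    obtain ⟨c, hc⟩ := hC.nonempty
    obtain ⟨d, hd, hcd⟩ := hC.exists_adj hc
    exact (hx.not_adj c (h2 (Finset.mem_union_left _ hc)) d
      (h2 (Finset.mem_union_left _ hd)) hcd).elim
  · obtain ⟨C, D, hC, -, -, rfl⟩ := hx
    refine (hy.not_isCycleSet hq hcyc ?_ hC).elim
    intro c hc
    rw [Finset.mem_compl]
    intro hcy
    exact Finset.mem_compl.1 (h1 hcy) (Finset.mem_union_left _ hc)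
  · obtain ⟨C, D, -, -, -, rfl⟩ := hx
    obtain ⟨C', D', -, -, -, rfl⟩ := hy
    have h3 : C ∪ D = C' ∪ D' := le_antisymm (Finset.compl_subset_compl.1 h1) h2
    rw [h3]

theorem complexFacets_whisker (hq : 1 ≤ q) (hcyc : ∀ C, H.IsCycleSet C → 2 * q - 1 ≤ C.card) :
    complexFacets (H.whisker.matchingFreeComplex q) = whiskerCompl '' H.whiskerFacetPairs q := by
  have hsub : ∀ F ∈ H.whisker.matchingFreeComplex q,
      ∃ x ∈ H.whiskerFacetPairs q, F ⊆ whiskerCompl x := by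
    intro F hF
    rw [mem_matchingFreeComplex_iff] at hF
    by_cases hs : H.SparseOn F.toLeft
    · obtain ⟨x, hx, h⟩ := exists_isCoverPair_of_sparseOn hF hs
      exact ⟨x, .inl hx, h⟩
    · obtain ⟨x, hx, h⟩ := exists_isCyclePair_of_not_sparseOn hF hcyc hs
      exact ⟨x, .inr hx, h⟩
  have hmem : ∀ x ∈ H.whiskerFacetPairs q,
      whiskerCompl x ∈ H.whisker.matchingFreeComplex q := by
    rintro x (hx | hx)
    exacts [hx.mem_matchingFreeComplex hq, hx.mem_matchingFreeComplex hq]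
  ext F
  constructor
  · intro hF
    obtain ⟨x, hx, h⟩ := hsub F hF.prop
    exact ⟨x, hx, (hF.eq_of_le (hmem x hx) h).symm⟩
  · rintro ⟨x, hx, rfl⟩
    refine ⟨hmem x hx, ?_⟩
    intro F hF hxF
    obtain ⟨y, hy, h⟩ := hsub F hF
    obtain ⟨h1, h2⟩ := whiskerCompl_subset_iff.1 (hxF.trans h)
    rw [whiskerFacetPairs_antichain hq hcyc hx hy h1 h2]
    exact h

/-- Vertices of `D` are isolated, so a cycle surviving the removal of `c` would lie in `C` minus `c`
and be too short. What remains is a forest. -/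
theorem IsCyclePair.exists_isCoverPair (hq : 1 ≤ q)
    (hcyc : ∀ C, H.IsCycleSet C → 2 * q - 1 ≤ C.card) (hC : H.IsCycleSet C)
    (hcard : C.card = 2 * q - 1) (hD : ∀ u ∈ D, ∀ v ∈ C ∪ D, ¬ H.Adj u v) {c : V} (hc : c ∈ C) :
    ∃ x, H.IsCoverPair (Fintype.card V + 1 - q) x ∧
      (whiskerCompl ((C ∪ D)ᶜ, C ∪ D)).erase (Sum.inl c) ⊆ whiskerCompl x := by
  have hmem : whiskerCompl ((C ∪ D)ᶜ, C ∪ D) ∈ H.whisker.matchingFreeComplex q :=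
    IsCyclePair.mem_matchingFreeComplex hq ⟨C, D, hC, hcard, hD, rfl⟩
  rw [mem_matchingFreeComplex_iff] at hmem
  refine exists_isCoverPair_of_sparseOn (fun h => hmem (h.mono (Finset.erase_subset _ _))) ?_
  by_contra hs
  obtain ⟨C', hC', hcs⟩ := exists_isCycleSet_of_not_sparseOn hs
  have hC'' : ∀ v ∈ C', v ≠ c ∧ v ∈ C ∪ D := by
    intro v hv
    have := Finset.mem_toLeft.1 (hC' hv)
    rw [Finset.mem_erase, inl_mem_whiskerCompl] at this
    exact ⟨fun h => this.1 (h ▸ rfl), not_not.1 (mt Finset.mem_compl.2 this.2)⟩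
  have hsub : C' ⊆ C.erase c := by
    intro v hv
    obtain ⟨d, hd, hvd⟩ := hcs.exists_adj hv
    refine Finset.mem_erase.2 ⟨(hC'' v hv).1, ?_⟩
    refine (Finset.mem_union.1 (hC'' v hv).2).resolve_right fun hvD => ?_
    exact hD v hvD d (hC'' d hd).2 hvd
  have h1 := Finset.card_le_card hsub
  rw [Finset.card_erase_of_mem hc] at h1
  have h2 := hcyc C' hcs
  omega

end Whisker

end SimpleGraph

/-! ### Colex comparison and exchange -/

theorem Finset.Colex.exists_of_toColex_image_le {V : Type*} {p : V → ℕ} (hp : Function.Injective p)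
    {s t : Finset V} (hne : s ≠ t) (hle : toColex (s.image p) ≤ toColex (t.image p)) :
    ∃ c ∈ t, c ∉ s ∧ ∀ b ∈ s, b ∉ t → p b < p c := by
  have hlt : toColex (s.image p) < toColex (t.image p) :=
    lt_of_le_of_ne hle fun h => hne (Finset.image_injective hp (toColex_inj.1 h))
  obtain ⟨a, ha, has, h⟩ := Finset.Colex.toColex_lt_toColex_iff_exists_forall_lt.1 hlt
  obtain ⟨c, hc, rfl⟩ := Finset.mem_image.1 ha
  exact ⟨c, hc, fun hcs => has (Finset.mem_image_of_mem _ hcs), fun b hb hbt =>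
    h (p b) (Finset.mem_image_of_mem _ hb) fun hbt' => hbt ((hp.mem_finset_image).1 hbt')⟩

theorem Finset.Colex.toColex_image_lt_exchange {V : Type*} [DecidableEq V] {p : V → ℕ}
    (hp : Function.Injective p) {s : Finset V} {b c : V} (hc : c ∉ s) (hbc : p b < p c) :
    toColex (s.image p) < toColex ((insert c (s.erase b)).image p) := by
  refine Finset.Colex.toColex_lt_toColex_iff_exists_forall_lt.2
    ⟨p c, Finset.mem_image_of_mem _ (Finset.mem_insert_self _ _), ?_, ?_⟩
  · rwa [hp.mem_finset_image]
  · intro x hx hx'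
    obtain ⟨a, ha, rfl⟩ := Finset.mem_image.1 hx
    rw [hp.mem_finset_image, Finset.mem_insert, Finset.mem_erase, not_or] at hx'
    have : a = b := by
      by_contra hab
      exact hx'.2 ⟨hab, ha⟩
    rwa [this]

namespace SimpleGraph

/-! ### The shelling order and the exchange steps -/

section Exchange

variable {V : Type*} [Fintype V] [DecidableEq V] {H : SimpleGraph V} {q r : ℕ}
  {x x' : Finset V × Finset V}

open Classical in
/-- The number by which the facets of `MF^q(W(H))` are ordered first. -/
noncomputable def whiskerRank (H : SimpleGraph V) (x : Finset V × Finset V) : ℕ :=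
  -- Among facet pairs, only cycle pairs have an edge inside `x.2`; the shift by `|V| + 1` puts them
  -- after all cover pairs.
  if ∃ u ∈ x.2, ∃ v ∈ x.2, H.Adj u v then Fintype.card V + 1 + x.2.card else x.2.card

/-- The key by which the facets of `MF^q(W(H))` are ordered; `p A` is an elimination order of the
complement of `A`. -/
noncomputable def whiskerKey (H : SimpleGraph V) (p : Finset V → V → ℕ)
    (x : Finset V × Finset V) : ℕ ×ₗ (Colex (Finset ℕ))ᵒᵈ :=
  toLex (H.whiskerRank x, OrderDual.toDual (toColex
    -- With `x.2` empty only `x.1` distinguishes the pairs, so one order independent of `x.1` is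
    -- needed.
    (if x.2 = ∅ then x.1.image (p ∅) else x.2.image (p x.1))))

omit [DecidableEq V] in
theorem IsCoverPair.whiskerRank_eq (hx : H.IsCoverPair r x) : H.whiskerRank x = x.2.card := by
  rw [whiskerRank, if_neg]
  rintro ⟨u, hu, v, hv, huv⟩
  exact hx.not_adj u hu v hv huv

theorem IsCyclePair.whiskerRank_eq (hx : H.IsCyclePair q x) :
    H.whiskerRank x = Fintype.card V + 1 + x.2.card := by
  rw [whiskerRank, if_pos]
  obtain ⟨C, D, hC, -, -, rfl⟩ := hx
  obtain ⟨c, hc⟩ := hC.nonempty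
  obtain ⟨d, hd, hcd⟩ := hC.exists_adj hc
  exact ⟨c, Finset.mem_union_left _ hc, d, Finset.mem_union_left _ hd, hcd⟩

theorem IsCoverPair.exchange_of_not_subset (hx : H.IsCoverPair r x) {c : V} (hc : c ∉ x.1)
    (hne : x.2.Nonempty) :
    ∃ x'', H.IsCoverPair r x'' ∧ x''.2.card < x.2.card ∧
      (whiskerCompl x).erase (Sum.inl c) ⊆ whiskerCompl x'' := by
  -- If `c` is in `x.2` it must itself be dropped to keep the pair disjoint; otherwise any element
  -- will do.
  obtain ⟨b, hb, hbc⟩ : ∃ b ∈ x.2, c ∉ x.2.erase b := by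
    by_cases hc2 : c ∈ x.2
    · exact ⟨c, hc2, by simp⟩
    · exact ⟨hne.choose, hne.choose_spec, fun h => hc2 (Finset.mem_of_mem_erase h)⟩
  have hlt := Finset.card_erase_lt_of_mem hb
  refine ⟨(insert c x.1, x.2.erase b), ⟨?_, ?_, ?_⟩, hlt, ?_⟩
  · rw [Finset.disjoint_insert_left]
    exact ⟨hbc, hx.disjoint.mono_right (Finset.erase_subset _ _)⟩
  · intro u hu v hv
    exact hx.not_adj u (Finset.mem_of_mem_erase hu) v (Finset.mem_of_mem_erase hv)
  · have h1 := hx.card_add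
    have h2 := Finset.card_pos.2 hne
    simp only [Finset.card_insert_of_notMem hc, Finset.card_erase_of_mem hb]
    omega
  · rw [subset_whiskerCompl_iff]
    constructor
    · intro i hi
      rcases Finset.mem_insert.1 hi with rfl | hi
      · simp
      · simp [hi]
    · intro i hi
      simp [Finset.mem_of_mem_erase hi]

theorem IsCoverPair.exchange_right (hx : H.IsCoverPair r x) (hx' : H.IsCoverPair r x')
    (h1 : x'.1 = x.1) (h2 : x'.2 ≠ x.2) {p : V → ℕ} (hp : Function.Injective p)
    (hp1 : ∀ v ∈ x.1ᶜ, ∀ u ∈ x.1ᶜ, ∀ u' ∈ x.1ᶜ, H.Adj v u → H.Adj v u' →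
      p u < p v → p u' < p v → u = u')
    (hle : toColex (x.2.image p) ≤ toColex (x'.2.image p)) :
    ∃ c ∈ x'.2, c ∉ x.2 ∧ ∃ B, H.IsCoverPair r (x.1, B) ∧ B.card = x.2.card ∧
      toColex (x.2.image p) < toColex (B.image p) ∧
      (whiskerCompl x).erase (Sum.inr c) ⊆ whiskerCompl (x.1, B) := by
  have hcard : x.2.card = x'.2.card := by
    have c1 := hx.card_add
    have c2 := hx'.card_add
    rw [h1] at c2
    omega
  have hxc : ∀ v ∈ x.2, v ∈ x.1ᶜ := fun v hv =>
    Finset.mem_compl.2 fun h => Finset.disjoint_left.1 hx.disjoint h hv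
  obtain ⟨c, hc', hc, hlt⟩ := Finset.Colex.exists_of_toColex_image_le hp h2.symm hle
  have hcc : c ∉ x.1 := fun h => Finset.disjoint_left.1 hx'.disjoint (h1 ▸ h) hc'
  -- A neighbour of `c` in `x.2` is not in the independent set `x'.2`, hence lies below `c`; by the
  -- elimination order there is at most one.
  have hnb : ∀ b ∈ x.2, H.Adj c b → p b < p c := fun b hb hcb =>
    hlt b hb fun hb' => hx'.not_adj c hc' b hb' hcb
  obtain ⟨b, hb, hbc, hbu⟩ : ∃ b ∈ x.2, p b < p c ∧ ∀ a ∈ x.2, H.Adj c a → a = b := by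
    by_cases hex : ∃ b ∈ x.2, H.Adj c b
    · obtain ⟨b, hb, hcb⟩ := hex
      exact ⟨b, hb, hnb b hb hcb, fun a ha hca => hp1 c (Finset.mem_compl.2 hcc) a (hxc a ha) b
        (hxc b hb) hca hcb (hnb a ha hca) (hnb b hb hcb)⟩
    · push Not at hex
      have hns : ¬ x.2 ⊆ x'.2 := fun hss => h2 (Finset.eq_of_subset_of_card_le hss hcard.ge).symm
      obtain ⟨b, hb, hb'⟩ := Finset.not_subset.1 hns
      exact ⟨b, hb, hlt b hb hb', fun a ha hca => absurd hca (hex a ha)⟩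
  have hcB : c ∉ x.2.erase b := fun h => hc (Finset.mem_of_mem_erase h)
  have hBc : (insert c (x.2.erase b)).card = x.2.card := by
    rw [Finset.card_insert_of_notMem hcB, Finset.card_erase_add_one hb]
  refine ⟨c, hc', hc, insert c (x.2.erase b), ⟨?_, ?_, ?_⟩, hBc,
    Finset.Colex.toColex_image_lt_exchange hp hc hbc, ?_⟩
  · rw [Finset.disjoint_insert_right]
    exact ⟨hcc, hx.disjoint.mono_right (Finset.erase_subset _ _)⟩
  · intro u hu v hv huv
    rcases Finset.mem_insert.1 hu with rfl | hu' <;>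
      rcases Finset.mem_insert.1 hv with rfl | hv'
    · exact H.irrefl huv
    · exact (Finset.mem_erase.1 hv').1 (hbu v (Finset.mem_of_mem_erase hv') huv)
    · exact (Finset.mem_erase.1 hu').1 (hbu u (Finset.mem_of_mem_erase hu') huv.symm)
    · exact hx.not_adj u (Finset.mem_of_mem_erase hu') v (Finset.mem_of_mem_erase hv') huv
  · rw [← hx.card_add, hBc]
  · rw [subset_whiskerCompl_iff]
    constructor
    · intro i hi
      simp [hi]
    · intro i hi
      rcases Finset.mem_insert.1 hi with rfl | hi
      · simp
      · simp [Finset.mem_of_mem_erase hi]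

/-- With no whisker ends removed there is no independence condition, and this is the exchange for
all `r`-subsets of the vertex set. -/
theorem IsCoverPair.exchange_left (hx : H.IsCoverPair r x) (hx' : H.IsCoverPair r x')
    (h1 : x.2 = ∅) (h1' : x'.2 = ∅) (h2 : x'.1 ≠ x.1) {p : V → ℕ} (hp : Function.Injective p)
    (hle : toColex (x.1.image p) ≤ toColex (x'.1.image p)) :
    ∃ c ∈ x'.1, c ∉ x.1 ∧ ∃ A, H.IsCoverPair r (A, ∅) ∧
      toColex (x.1.image p) < toColex (A.image p) ∧
      (whiskerCompl x).erase (Sum.inl c) ⊆ whiskerCompl (A, ∅) := by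
  have hcard : x.1.card = r := by simpa [h1] using hx.card_add
  have hcard' : x'.1.card = r := by simpa [h1'] using hx'.card_add
  obtain ⟨c, hc', hc, hlt⟩ := Finset.Colex.exists_of_toColex_image_le hp h2.symm hle
  have hns : ¬ x.1 ⊆ x'.1 := fun hss =>
    h2 (Finset.eq_of_subset_of_card_le hss (by omega)).symm
  obtain ⟨b, hb, hb'⟩ := Finset.not_subset.1 hns
  have hcA : c ∉ x.1.erase b := fun h => hc (Finset.mem_of_mem_erase h)
  refine ⟨c, hc', hc, insert c (x.1.erase b), ⟨?_, ?_, ?_⟩,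
    Finset.Colex.toColex_image_lt_exchange hp hc (hlt b hb hb'), ?_⟩
  · simp
  · simp
  · rw [Finset.card_insert_of_notMem hcA, Finset.card_erase_add_one hb, hcard, Finset.card_empty,
      add_zero]
  · rw [subset_whiskerCompl_iff]
    constructor
    · intro i hi
      rcases Finset.mem_insert.1 hi with rfl | hi
      · simp
      · simp [Finset.mem_of_mem_erase hi]
    · simp

theorem IsCoverPair.exchange (hx : H.IsCoverPair r x) (hx' : H.IsCoverPair r x') (hne : x' ≠ x)
    {p : Finset V → V → ℕ} (hp : ∀ A, Function.Injective (p A))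
    (hp1 : ∀ v ∈ x.1ᶜ, ∀ u ∈ x.1ᶜ, ∀ u' ∈ x.1ᶜ, H.Adj v u → H.Adj v u' →
      p x.1 u < p x.1 v → p x.1 u' < p x.1 v → u = u')
    (hle : H.whiskerKey p x' ≤ H.whiskerKey p x) :
    ∃ w ∈ whiskerCompl x, w ∉ whiskerCompl x' ∧ ∃ x'', H.IsCoverPair r x'' ∧
      H.whiskerKey p x'' < H.whiskerKey p x ∧ (whiskerCompl x).erase w ⊆ whiskerCompl x'' := by
  rw [whiskerKey, whiskerKey, Prod.Lex.toLex_le_toLex, hx.whiskerRank_eq, hx'.whiskerRank_eq,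
    OrderDual.toDual_le_toDual] at hle
  simp only at hle
  rcases x.2.eq_empty_or_nonempty with h0 | h0
  · have h0' : x'.2 = ∅ := by
      rw [h0, Finset.card_empty] at hle
      rcases hle with hle | hle
      · omega
      · exact Finset.card_eq_zero.1 hle.1
    have h2 : x'.1 ≠ x.1 := fun h => hne (Prod.ext h (h0'.trans h0.symm))
    have hle' := (hle.resolve_left (by simp [h0, h0'])).2
    rw [if_pos h0, if_pos h0'] at hle'
    obtain ⟨c, hc', hc, A, hA, hlt, hsub⟩ := hx.exchange_left hx' h0 h0' h2 (hp ∅) hle'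
    refine ⟨Sum.inl c, by simpa using hc, by simpa using hc', _, hA, ?_, hsub⟩
    rw [whiskerKey, whiskerKey, Prod.Lex.toLex_lt_toLex, hx.whiskerRank_eq, hA.whiskerRank_eq]
    refine .inr ⟨by simp [h0], ?_⟩
    simp only [if_pos h0, if_true]
    exact OrderDual.toDual_lt_toDual.2 hlt
  -- If so, `|x'.2| ≤ |x.2|` and the equal totals force `x'.1 = x.1`, so both sets are compared in
  -- the same order `p x.1`.
  by_cases hss : x'.1 ⊆ x.1
  · have hc1 := Finset.card_le_card hss
    have hc2 := hx.card_add
    have hc3 := hx'.card_add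
    have hcle : x'.2.card ≤ x.2.card := hle.elim (fun h => h.le) (fun h => h.1.le)
    have h1 : x'.1 = x.1 := Finset.eq_of_subset_of_card_le hss (by omega)
    have h2 : x'.2 ≠ x.2 := fun h => hne (Prod.ext h1 h)
    have hcard : x'.2.card = x.2.card := by
      rw [h1] at hc3
      omega
    have h0' : x'.2.Nonempty := Finset.card_pos.1 (hcard ▸ Finset.card_pos.2 h0)
    have hle' := (hle.resolve_left (by omega)).2
    rw [if_neg h0.ne_empty, if_neg h0'.ne_empty, h1] at hle'
    obtain ⟨c, hc', hc, B, hB, hBc, hlt, hsub⟩ :=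
      hx.exchange_right hx' h1 h2 (hp x.1) hp1 hle'
    have hB0 : B.Nonempty := Finset.card_pos.1 (hBc ▸ Finset.card_pos.2 h0)
    refine ⟨Sum.inr c, by simpa using hc, by simpa using hc', _, hB, ?_, hsub⟩
    rw [whiskerKey, whiskerKey, Prod.Lex.toLex_lt_toLex, hx.whiskerRank_eq, hB.whiskerRank_eq]
    refine .inr ⟨hBc, ?_⟩
    simp only [if_neg h0.ne_empty, if_neg hB0.ne_empty]
    exact OrderDual.toDual_lt_toDual.2 hlt
  · obtain ⟨c, hc', hc⟩ := Finset.not_subset.1 hss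
    obtain ⟨x'', hx'', hlt, hsub⟩ := hx.exchange_of_not_subset hc h0
    refine ⟨Sum.inl c, by simpa using hc, by simpa using hc', x'', hx'', ?_, hsub⟩
    rw [whiskerKey, whiskerKey, Prod.Lex.toLex_lt_toLex, hx.whiskerRank_eq, hx''.whiskerRank_eq]
    exact .inl hlt

theorem whiskerKey_lt_of_rank_lt {p : Finset V → V → ℕ} (h : H.whiskerRank x' < H.whiskerRank x) :
    H.whiskerKey p x' < H.whiskerKey p x := by
  rw [whiskerKey, whiskerKey, Prod.Lex.toLex_lt_toLex]
  exact .inl h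

theorem whiskerRank_le_of_key_le {p : Finset V → V → ℕ}
    (h : H.whiskerKey p x' ≤ H.whiskerKey p x) : H.whiskerRank x' ≤ H.whiskerRank x := by
  rw [whiskerKey, whiskerKey, Prod.Lex.toLex_le_toLex] at h
  exact h.elim (fun h => h.le) (fun h => h.1.le)

theorem IsCyclePair.exchange (hq : 1 ≤ q) (hcyc : ∀ C, H.IsCycleSet C → 2 * q - 1 ≤ C.card)
    (hx : H.IsCyclePair q x) (hx' : x' ∈ H.whiskerFacetPairs q) (hne : x' ≠ x)
    {p : Finset V → V → ℕ} (hle : H.whiskerKey p x' ≤ H.whiskerKey p x) :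
    ∃ w ∈ whiskerCompl x, w ∉ whiskerCompl x' ∧ ∃ x'' ∈ H.whiskerFacetPairs q,
      H.whiskerKey p x'' < H.whiskerKey p x ∧ (whiskerCompl x).erase w ⊆ whiskerCompl x'' := by
  have hrank := hx.whiskerRank_eq
  have hcp := hx
  obtain ⟨C, D, hC, hcard, hD, rfl⟩ := hx
  by_cases hex : ∃ c ∈ C, c ∈ x'.1
  · obtain ⟨c, hc, hcx⟩ := hex
    obtain ⟨x'', hx'', hsub⟩ := IsCyclePair.exists_isCoverPair hq hcyc hC hcard hD hc
    refine ⟨Sum.inl c, by simp [hc], by simpa using hcx, x'', .inl hx'',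
      whiskerKey_lt_of_rank_lt ?_, hsub⟩
    rw [hrank, hx''.whiskerRank_eq]
    have := Finset.card_le_univ x''.2
    omega
  push Not at hex
  rcases hx' with hx' | hx'
  · exact (hx'.not_isCycleSet hq hcyc (fun c hc => Finset.mem_compl.2 (hex c hc)) hC).elim
  have hle' := whiskerRank_le_of_key_le hle
  rw [hrank, hx'.whiskerRank_eq] at hle'
  obtain ⟨C', D', hC', hcard', hD', rfl⟩ := hx'
  simp only [Finset.mem_compl, not_not] at hex hle'
  -- A vertex of `C` has a neighbour in `C`, so it cannot be one of the isolated vertices `D'`.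
  have hCC : C = C' := by
    refine Finset.eq_of_subset_of_card_le (fun c hc => ?_) (by omega)
    refine (Finset.mem_union.1 (hex c hc)).resolve_right fun hcD => ?_
    obtain ⟨d, hd, hcd⟩ := hC.exists_adj hc
    exact hD' c hcD d (hex d hd) hcd
  subst hCC
  -- The order gives `|C ∪ D'| ≤ |C ∪ D|`, so inclusion would be equality.
  have hns : ¬ C ∪ D ⊆ C ∪ D' := by
    intro hss
    have := Finset.eq_of_subset_of_card_le hss (by omega)
    exact hne (by rw [this])
  obtain ⟨d, hd, hd'⟩ := Finset.not_subset.1 hns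
  have hdC : d ∉ C := fun h => hd' (Finset.mem_union_left _ h)
  have hCD : C ∪ D.erase d = (C ∪ D).erase d := by
    rw [Finset.erase_union_distrib, Finset.erase_eq_of_notMem hdC]
  have hnew : H.IsCyclePair q ((C ∪ D.erase d)ᶜ, C ∪ D.erase d) := by
    refine ⟨C, D.erase d, hC, hcard, fun u hu v hv => ?_, rfl⟩
    rw [hCD] at hv
    exact hD u (Finset.mem_of_mem_erase hu) v (Finset.mem_of_mem_erase hv)
  refine ⟨Sum.inl d, inl_mem_whiskerCompl.2 fun h => Finset.mem_compl.1 h hd,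
    fun h => inl_mem_whiskerCompl.1 h (Finset.mem_compl.2 hd'), _, .inr hnew,
    whiskerKey_lt_of_rank_lt ?_, ?_⟩
  · rw [hrank, hnew.whiskerRank_eq]
    simp only [hCD]
    have := Finset.card_erase_lt_of_mem hd
    omega
  · rw [subset_whiskerCompl_iff, hCD]
    constructor
    · intro i hi h
      rw [Finset.mem_erase, inl_mem_whiskerCompl, Finset.mem_compl, not_not] at h
      exact Finset.mem_compl.1 hi (Finset.mem_erase.2 ⟨fun hid => h.1 (hid ▸ rfl), h.2⟩)
    · intro i hi h
      exact inr_mem_whiskerCompl.1 (Finset.mem_of_mem_erase h) (Finset.mem_of_mem_erase hi)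

/-- `MF^q(W(H))` is shellable if every cycle of `H` has length at least `2q - 1`. -/
theorem isShellableComplex_whisker (hq : 1 ≤ q)
    (hcyc : ∀ C, H.IsCycleSet C → 2 * q - 1 ≤ C.card) :
    IsShellableComplex (H.whisker.matchingFreeComplex q) := by
  -- An arbitrary injection serves when the complement of `A` is not a forest; no cover pair has
  -- such an `A`.
  have hex : ∀ A : Finset V, ∃ p : V → ℕ, Function.Injective p ∧ (H.SparseOn Aᶜ →
      ∀ v ∈ Aᶜ, ∀ u ∈ Aᶜ, ∀ u' ∈ Aᶜ, H.Adj v u → H.Adj v u' →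
        p u < p v → p u' < p v → u = u') := by
    intro A
    by_cases h : H.SparseOn Aᶜ
    · obtain ⟨p, hp, hp1⟩ := h.exists_order
      exact ⟨p, hp, fun _ => hp1⟩
    · exact ⟨fun v => Fintype.equivFin V v, fun a b hab => by
        simpa [Fin.val_inj] using hab, fun h' => absurd h' h⟩
  choose p hp hp1 using hex
  refine isShellableComplex_of_key (Set.toFinite (H.whiskerFacetPairs q)) whiskerCompl ?_
    (complexFacets_whisker hq hcyc) (H.whiskerKey p) ?_
  · intro x hx y hy hxy
    obtain ⟨h1, h2⟩ := whiskerCompl_subset_iff.1 hxy.subset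
    exact whiskerFacetPairs_antichain hq hcyc hx hy h1 h2
  · rintro x hx x' hx' hne hle
    rcases hx with hx | hx
    · rcases hx' with hx' | hx'
      · obtain ⟨w, hw, hw', x'', hx'', h⟩ :=
          hx.exchange hx' hne hp (hp1 x.1 (hx.sparseOn hq hcyc)) hle
        exact ⟨w, hw, hw', x'', .inl hx'', h⟩
      · have hle' := whiskerRank_le_of_key_le hle
        rw [hx.whiskerRank_eq, hx'.whiskerRank_eq] at hle'
        have := Finset.card_le_univ x.2
        omega
    · exact hx.exchange hq hcyc hx' hne hle

end Exchange

end SimpleGraph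

theorem theorem5 {V : Type*} [Finite V] (H : SimpleGraph V) :
    (¬ H.IsAcyclic → ∀ q : ℕ, 1 ≤ q → q ≤ ⌈(H.girth : ℚ) / 2⌉₊ →
      IsShellableComplex (H.whisker.matchingFreeComplex q)) ∧
    (H.IsAcyclic → ∀ q : ℕ, 1 ≤ q → q ≤ H.whisker.matchingNum →
      IsShellableComplex (H.whisker.matchingFreeComplex q)) := by
  classical
  have := Fintype.ofFinite V
  refine ⟨fun _ q hq hqm => ?_, fun h q hq _ => ?_⟩
  · refine SimpleGraph.isShellableComplex_whisker hq ?_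
    rintro C ⟨a, w, hw, hC⟩
    rw [SimpleGraph.IsCycleSet.card_eq hw hC]
    refine le_trans ?_ (SimpleGraph.girth_le_length hw)
    -- From q - 1 < ⌈m/2⌉ follows 2(q - 1) < m, that is m ≥ 2q - 1.
    have h1 : ((q - 1 : ℕ) : ℚ) < (H.girth : ℚ) / 2 := Nat.lt_ceil.1 (by omega)
    have h2 : ((2 * (q - 1) : ℕ) : ℚ) < H.girth := by
      push_cast
      linarith
    have h3 : 2 * (q - 1) < H.girth := by exact_mod_cast h2
    omega
  · refine SimpleGraph.isShellableComplex_whisker hq ?_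
    rintro C ⟨a, w, hw, -⟩
    exact absurd hw (h w)
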